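/- Let $(S_n)_{n\ge 0}$ be a random walk on a countable group $G$ with identity $e$: $P(S_0=e)=1$ and the increments $\xi_n=S_{n-1}^{-1}S_n$, $n\ge1$, are i.i.d. Let $\gamma=P(S_n\ne e\ \forall n\ge 1)$ and assume that the walk is transient, i.e. $\gamma>0$. For $n\ge1$ and $x\in G$ let $\ell(n-1,x)=\#\{0\le i\le n-1: S_i=x\}$; for $f:\{0,1,2,\dots\}\to\mathbb{R}$ with $f(0)=0$ let $G_n(f)=\sum_{x\in G}f(\ell(n-1,x))$, and for $j\ge1$ let $R_n^{(j)}=\#\{x\in G:\ell(n-1,x)=j\}$. Let $\tau_0=0$ and $\tau_j=\inf\{n>\tau_{j-1}:S_n=e\}$ for $j\ge1$ (with $\inf\emptyset=\infty$), and let $\tau=\tau_1=\inf\{n\ge1:S_n=e\}$. Then: (a) $E R_n^{(j)}\ \ge\ \gamma^2\,E\max(n-\tau_{j-1},0)$ for all $n,j\ge1$. (b) Suppose moreover that $P(\tau<\infty)>0$ (equivalently $\gamma<1$) and $E(\tau\mid\tau<\infty)<\infty$. Put $f(0)=0$ and $f(j)=(1-\gamma)^{-j/2}$ for $j\ge1$.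 Then $\sum_{j\ge1}f(j)^2(1-\gamma)^j/j=\infty$, while $\sum_{j\ge1}f(j)^2(1-\gamma)^j/j^{1+\delta}<\infty$ for every $\delta>0$; each $G_n(f)/n$, $n\ge1$, is square integrable, but $G_n(f)/n$ does not converge in $L^2$ (to any limit) as $n\to\infty$. -/

import Mathlib

open MeasureTheory ProbabilityTheory Filter Topology
open scoped ENNReal

noncomputable section

namespace GroupWalk

variable {Ω G : Type*} [MeasurableSpace Ω] [Group G] [MeasurableSpace G]

/-- The process `S` is a random walk on the group `G` starting from the identity, under the
probability measure `P`: the increments `S_n⁻¹ S_{n+1}`, `n ≥ 0`, are independent and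
identically distributed. -/
structure IsRandomWalk (S : ℕ → Ω → G) (P : Measure Ω) : Prop where
  measurable : ∀ n, Measurable (S n)
  start : ∀ᵐ ω ∂P, S 0 ω = 1
  indep : iIndepFun (fun n ω => (S n ω)⁻¹ * S (n + 1) ω) P
  identDistrib : ∀ n, IdentDistrib (fun ω => (S n ω)⁻¹ * S (n + 1) ω)
    (fun ω => (S 0 ω)⁻¹ * S 1 ω) P P

/-- The escape probability `γ = P(S_n ≠ e for all n ≥ 1)`. -/
def escapeProb (S : ℕ → Ω → G) (P : Measure Ω) : ℝ :=
  P.real {ω | ∀ n, 1 ≤ n → S n ω ≠ 1}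

/-- The walk is transient: with positive probability it never returns to its starting point. -/
def IsTransient (S : ℕ → Ω → G) (P : Measure Ω) : Prop :=
  0 < escapeProb S P

end GroupWalk

namespace GroupWalk

variable {Ω G : Type*} [Group G]

/-- The first return time `τ = inf {n ≥ 1 : S_n = e}`, with `inf ∅ = ∞`. -/
def firstReturnTime (S : ℕ → Ω → G) (ω : Ω) : ℕ∞ :=
  sInf {t : ℕ∞ | ∃ n : ℕ, t = n ∧ 1 ≤ n ∧ S n ω = 1}

/-- The successive return times: `τ_0 = 0` and `τ_{j+1} = inf {n > τ_j : S_n = e}`, with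
`inf ∅ = ∞`. -/
def returnTime (S : ℕ → Ω → G) : ℕ → Ω → ℕ∞
  | 0, _ => 0
  | j + 1, ω => sInf {t : ℕ∞ | ∃ n : ℕ, t = n ∧ returnTime S j ω < n ∧ S n ω = 1}

open Classical in
/-- The local time `ℓ(n-1, x)`, that is, the number of `i ∈ {0, …, n-1}` with `S_i = x`
(so it is `0` for `n = 0`). -/
def localTimeBefore (S : ℕ → Ω → G) (n : ℕ) (x : G) (ω : Ω) : ℕ :=
  ((Finset.range n).filter (fun i => S i ω = x)).card

/-- The functional `G_n(f) = ∑_{x ∈ G} f(ℓ(n-1, x))`; when `f 0 = 0` only finitely many terms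
are nonzero. -/
def localTimeSum (S : ℕ → Ω → G) (f : ℕ → ℝ) (n : ℕ) (ω : Ω) : ℝ :=
  ∑' x : G, f (localTimeBefore S n x ω)

/-- The multiple range `R_n^{(j)}`: the number of points of `G` visited exactly `j` times up to
time `n - 1`. -/
def multipleRange (S : ℕ → Ω → G) (n j : ℕ) (ω : Ω) : ℕ∞ :=
  {x : G | localTimeBefore S n x ω = j}.encard

end GroupWalk

end

noncomputable section

namespace GroupWalk

/-! ### Local times and return times along one path -/

section Deterministic

variable {Ω G : Type*} {S : ℕ → Ω → G} {ω : Ω}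

/-! Write γ for the escape probability and q = 1 - γ. For (a), a site visited exactly r + 1 times
before n is counted at its first visit, at time i: the position at time i is new, and the walk
restarted at i is at its starting point exactly r + 1 times during the remaining n - i instants.
These two events are independent. The first has probability at least γ (`measure_firstVisit`); the
second has probability at least γ P(τ_r < n - i), because escaping right after the r-th return
suffices (`measure_neverReturns_mul_le`). Summing P(τ_r < n - i) over i gives E max(n - τ_r, 0).

For (b), the strong Markov property gives P(τ_r < ∞) = q^r and E(τ_r; τ_r < ∞) ≤ r q^r M, where M ≥
E(τ | τ < ∞). With n = 4Mm and r ≤ 2m, (a) then yields E R_n^(r+1) ≥ γ² · 2Mm · q^r. Let h be f cut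
down to (m, 2m]. Since f(j)² q^j = 1, each of these m values of j contributes at least 2γ²Mm to E
G_n(h)², so G_n(h)/n has second moment at least γ²/(8M). Yet G_n(h) vanishes unless some site is
visited more than m times, which has probability at most n q^m → 0. Convergence of G_n(f)/n in L²
would make the squares uniformly integrable, and then the dominated G_n(h)/n would tend to 0 in L²,
a contradiction (`tendsto_eLpNorm_zero_of_le_of_measure_ne_zero`). -/

lemma localTimeBefore_zero (z : G) : localTimeBefore S 0 z ω = 0 := by
  simp [localTimeBefore]

open Classical in
lemma localTimeBefore_succ (n : ℕ) (z : G) :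
    localTimeBefore S (n + 1) z ω = localTimeBefore S n z ω + if S n ω = z then 1 else 0 := by
  unfold localTimeBefore
  rw [Finset.range_add_one, Finset.filter_insert]
  split_ifs <;> simp

lemma localTimeBefore_mono {m n : ℕ} (h : m ≤ n) (z : G) :
    localTimeBefore S m z ω ≤ localTimeBefore S n z ω := by
  classical
  unfold localTimeBefore
  gcongr

lemma localTimeBefore_pos_iff (n : ℕ) (z : G) :
    0 < localTimeBefore S n z ω ↔ ∃ i < n, S i ω = z := by
  simp [localTimeBefore, Finset.card_pos, Finset.filter_nonempty_iff]

/-- The count grows by at most one per step, so it exceeds r only by passing through the visit made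
when it equals r. -/
lemma lt_localTimeBefore_iff (n r : ℕ) (z : G) :
    r < localTimeBefore S n z ω ↔ ∃ k < n, S k ω = z ∧ localTimeBefore S k z ω = r := by
  classical
  induction n with
  | zero => simp [localTimeBefore_zero]
  | succ n ih =>
    rw [localTimeBefore_succ]
    constructor
    · intro h
      by_cases h' : r < localTimeBefore S n z ω
      · obtain ⟨k, hk, hk'⟩ := ih.1 h'
        exact ⟨k, by omega, hk'⟩
      · split_ifs at h with hz
        · exact ⟨n, by omega, hz, by omega⟩
        · omega
    · rintro ⟨k, hk, hk'⟩
      rcases Nat.lt_succ_iff_lt_or_eq.1 hk with h | rfl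
      · have := ih.2 ⟨k, h, hk'⟩
        omega
      · rw [if_pos hk'.1]
        omega

lemma sInf_natCast_lt_iff {p : ℕ → Prop} {n : ℕ} :
    sInf {t : ℕ∞ | ∃ k : ℕ, t = k ∧ p k} < n ↔ ∃ k < n, p k := by
  rw [sInf_lt_iff]
  constructor
  · rintro ⟨_, ⟨k, rfl, hk⟩, h⟩
    exact ⟨k, by exact_mod_cast h, hk⟩
  · rintro ⟨k, h, hk⟩
    exact ⟨k, ⟨k, rfl, hk⟩, by exact_mod_cast h⟩

variable [Group G]

/-- Time 0 is itself a visit to the identity, so the r-th return is visit number r + 1; hence the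
strict inequality on the right. -/
lemma returnTime_lt_iff (h0 : S 0 ω = 1) (r n : ℕ) :
    returnTime S r ω < n ↔ r < localTimeBefore S n 1 ω := by
  induction r generalizing n with
  | zero =>
    rw [localTimeBefore_pos_iff, returnTime]
    constructor
    · intro h
      exact ⟨0, by exact_mod_cast h, h0⟩
    · rintro ⟨i, hi, -⟩
      exact_mod_cast (Nat.zero_le i).trans_lt hi
  | succ r ih =>
    rw [returnTime, sInf_natCast_lt_iff, lt_localTimeBefore_iff]
    simp_rw [ih]
    constructor
    · rintro ⟨k, hk, hr, hS⟩
      refine (lt_localTimeBefore_iff n (r + 1) 1).1 ?_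
      classical
      have := localTimeBefore_mono (S := S) (ω := ω) (Nat.succ_le_of_lt hk) 1
      rw [localTimeBefore_succ, if_pos hS] at this
      omega
    · rintro ⟨k, hk, hS, hr⟩
      exact ⟨k, hk, by omega, hS⟩

lemma returnTime_eq_iff (h0 : S 0 ω = 1) (r k : ℕ) :
    returnTime S r ω = k ↔ S k ω = 1 ∧ localTimeBefore S k 1 ω = r := by
  classical
  have h1 : returnTime S r ω = k ↔
      returnTime S r ω < ((k + 1 : ℕ) : ℕ∞) ∧ ¬ returnTime S r ω < (k : ℕ∞) := by
    cases returnTime S r ω with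
    | top => simp
    | coe a => norm_cast; omega
  rw [h1, returnTime_lt_iff h0, returnTime_lt_iff h0, localTimeBefore_succ]
  split_ifs with h
  · simp only [h, true_and]
    omega
  · simp [h]

lemma firstReturnTime_eq : firstReturnTime S ω = returnTime S 1 ω := by
  simp [firstReturnTime, returnTime, Nat.one_le_iff_ne_zero, Nat.pos_iff_ne_zero]

lemma returnTime_one_lt_iff (n : ℕ) :
    returnTime S 1 ω < n ↔ ∃ k < n, 1 ≤ k ∧ S k ω = 1 := by
  rw [← firstReturnTime_eq, firstReturnTime, sInf_natCast_lt_iff]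

lemma returnTime_one_lt_top_iff :
    returnTime S 1 ω < ⊤ ↔ ∃ k, 1 ≤ k ∧ S k ω = 1 := by
  constructor
  · intro h
    obtain ⟨n, hn⟩ := ENat.ne_top_iff_exists.1 h.ne
    obtain ⟨k, -, hk⟩ := (returnTime_one_lt_iff (S := S) (ω := ω) (n + 1)).1
      (by rw [← hn]; norm_cast; omega)
    exact ⟨k, hk⟩
  · rintro ⟨k, hk⟩
    exact ((returnTime_one_lt_iff (k + 1)).2 ⟨k, by omega, hk⟩).trans (ENat.natCast_lt_top _)

/-- Subtraction in `ℝ≥0∞` truncates, so the left side is max(n - τ_r, 0), and 0 when τ_r = ∞. It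
counts the m < n with τ_r ≤ m. -/
lemma natCast_sub_returnTime_eq_sum (h0 : S 0 ω = 1) (n r : ℕ) :
    (n : ℝ≥0∞) - (returnTime S r ω : ℝ≥0∞) =
      ∑ m ∈ Finset.range n,
        {ω | r < localTimeBefore S (m + 1) 1 ω}.indicator (fun _ => (1 : ℝ≥0∞)) ω := by
  classical
  simp only [Set.indicator_apply, Set.mem_ofPred_eq, ← returnTime_lt_iff h0, Finset.sum_boole]
  cases returnTime S r ω with
  | top => simp
  | coe a =>
    have : (Finset.range n).filter (fun m => (a : ℕ∞) < ((m + 1 : ℕ) : ℕ∞)) = Finset.Ico a n := by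
      ext m
      simp only [Finset.mem_filter, Finset.mem_range, Finset.mem_Ico]
      norm_cast
      omega
    rw [this, Nat.card_Ico, ENat.toENNReal_coe]
    push_cast
    rfl

end Deterministic

/-! ### The walk as a function of its increments -/

section Walk

variable {G : Type*} [Group G]

/-- The random walk started at the identity, as a function of its sequence of increments. -/
def walk : ℕ → (ℕ → G) → G
  | 0, _ => 1
  | n + 1, x => walk n x * x n

/-- The sequence of increments from time `k` on. -/
def shift (k : ℕ) (x : ℕ → G) : ℕ → G := fun n => x (k + n)

@[simp] lemma walk_zero (x : ℕ → G) : walk 0 x = 1 := rfl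

lemma walk_add (k l : ℕ) (x : ℕ → G) : walk (k + l) x = walk k x * walk l (shift k x) := by
  induction l with
  | zero => simp
  | succ l ih => rw [← add_assoc, walk, walk, ih, mul_assoc]; rfl

lemma walk_congr {n : ℕ} {x y : ℕ → G} (h : ∀ i < n, x i = y i) : walk n x = walk n y := by
  induction n with
  | zero => rfl
  | succ n ih => rw [walk, walk, ih fun i hi => h i (by omega), h n (by omega)]

lemma localTimeBefore_congr {n : ℕ} {x y : ℕ → G} (h : ∀ i < n, x i = y i) (z : G) :
    localTimeBefore walk n z x = localTimeBefore walk n z y := by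
  classical
  unfold localTimeBefore
  congr 1
  refine Finset.filter_congr fun i hi => ?_
  rw [walk_congr fun j hj => h j (hj.trans (Finset.mem_range.1 hi))]

/-- By left invariance, visits to the time-i position from time i on are visits of the restarted
walk to the identity. -/
lemma localTimeBefore_walk_add (i l : ℕ) (x : ℕ → G) :
    localTimeBefore walk (i + l) (walk i x) x =
      localTimeBefore walk i (walk i x) x + localTimeBefore walk l 1 (shift i x) := by
  classical
  induction l with
  | zero => simp [localTimeBefore_zero]
  | succ l ih =>
    rw [← add_assoc, localTimeBefore_succ, localTimeBefore_succ, ih, walk_add, add_assoc]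
    simp

lemma returnTime_succ_eq_add {r i : ℕ} {x : ℕ → G} (h : returnTime walk r x = i) :
    returnTime walk (r + 1) x = i + returnTime walk 1 (shift i x) := by
  obtain ⟨h1, h2⟩ := (returnTime_eq_iff (walk_zero x) r i).1 h
  have key : ∀ n : ℕ, returnTime walk (r + 1) x < n ↔
      (i : ℕ∞) + returnTime walk 1 (shift i x) < n := by
    intro n
    rw [returnTime_lt_iff (walk_zero x)]
    rcases le_total n i with hn | hn
    · have h3 := localTimeBefore_mono (S := walk) (ω := x) hn 1
      have h4 : (n : ℕ∞) ≤ i + returnTime walk 1 (shift i x) :=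
        le_add_right (by exact_mod_cast hn)
      simp only [not_lt.2 h4, iff_false]
      omega
    · obtain ⟨l, rfl⟩ := Nat.exists_eq_add_of_le hn
      have h3 := localTimeBefore_walk_add i l x
      rw [h1, h2] at h3
      rw [h3, Nat.cast_add, ENat.add_lt_add_iff_left (ENat.natCast_ne_top i),
        returnTime_lt_iff (walk_zero _)]
      omega
  -- An element of `ℕ∞` is determined by the naturals below it, so comparison with finite n also
  -- covers the value ∞.
  refine le_antisymm (ENat.forall_natCast_le_iff_le.1 ?_) (ENat.forall_natCast_le_iff_le.1 ?_) <;>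
    intro n hn <;> rw [← not_lt] at hn ⊢
  · rwa [← key]
  · rwa [key]

lemma dependsOn_walk (n : ℕ) : DependsOn (walk n : (ℕ → G) → G) (Set.Iio n) :=
  fun _ _ h => walk_congr h

lemma dependsOn_localTimeBefore (n : ℕ) :
    DependsOn (fun (x : ℕ → G) z => localTimeBefore walk n z x) (Set.Iio n) :=
  fun _ _ h => funext fun z => localTimeBefore_congr h z

lemma dependsOn_localTimeBefore_walk (n : ℕ) :
    DependsOn (fun x : ℕ → G => (walk n x, fun z => localTimeBefore walk n z x)) (Set.Iio n) :=
  fun _ _ h => Prod.ext (dependsOn_walk n h) (dependsOn_localTimeBefore n h)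

end Walk

/-! ### Measurability with respect to the past -/

section Measurability

lemma _root_.DependsOn.postcomp {ι α β γ : Type*} {F : (ι → α) → β} {s : Set ι} (hF : DependsOn F s)
    (g : β → γ) : DependsOn (fun x => g (F x)) s :=
  fun _ _ h => congrArg g (hF h)

variable {G : Type*} [MeasurableSpace G]

/-- The σ-algebra generated by the first `k` increments. -/
abbrev past (G : Type*) [MeasurableSpace G] (k : ℕ) : MeasurableSpace (ℕ → G) :=
  ⨆ i ∈ Set.Iio k, MeasurableSpace.comap (fun x : ℕ → G => x i) inferInstance

lemma past_le (k : ℕ) : past G k ≤ MeasurableSpace.pi :=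
  iSup₂_le fun i _ => (measurable_pi_apply i).comap_le

/-- Such a function factors through finitely many coordinates in a countable discrete space, where
every map is measurable. -/
lemma measurable_past_of_dependsOn [Countable G] [MeasurableSingletonClass G] {β : Type*}
    [MeasurableSpace β] [Nonempty β] {F : (ℕ → G) → β} {k : ℕ} (hF : DependsOn F (Set.Iio k)) :
    Measurable[past G k] F := by
  obtain ⟨g, rfl⟩ := dependsOn_iff_exists_comp.1 hF
  refine (Measurable.of_discrete (f := g)).comp ?_
  refine (@measurable_pi_iff _ _ _ (past G k) _ _).2 fun i => ?_
  refine Measurable.mono (comap_measurable fun x : ℕ → G => x i) ?_ le_rfl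
  exact le_iSup₂_of_le (f := fun (i : ℕ) (_ : i ∈ Set.Iio k) =>
    MeasurableSpace.comap (fun x : ℕ → G => x i) inferInstance) i.1 i.2 le_rfl

lemma measurable_of_dependsOn [Countable G] [MeasurableSingletonClass G] {β : Type*}
    [MeasurableSpace β] [Nonempty β] {F : (ℕ → G) → β} {k : ℕ} (hF : DependsOn F (Set.Iio k)) :
    Measurable F :=
  (measurable_past_of_dependsOn hF).mono (past_le k) le_rfl

lemma measurable_shift (k : ℕ) : Measurable (shift k : (ℕ → G) → ℕ → G) :=
  measurable_pi_iff.2 fun _ => measurable_pi_apply _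

variable [Group G]

variable [Countable G] [MeasurableSingletonClass G]

lemma measurable_comp_localTimeBefore {β : Type*} [MeasurableSpace β] [Nonempty β] (n : ℕ)
    (g : (G → ℕ) → β) :
    Measurable fun x : ℕ → G => g fun z => localTimeBefore walk n z x :=
  measurable_of_dependsOn ((dependsOn_localTimeBefore n).postcomp g)

lemma measurableSet_past_visit (n : ℕ) (p : G → (G → ℕ) → Prop) :
    MeasurableSet[past G n]
      {x : ℕ → G | p (walk n x) fun z => localTimeBefore walk n z x} :=
  measurable_past_of_dependsOn (β := Prop)
    ((dependsOn_localTimeBefore_walk n).postcomp fun a => p a.1 a.2) (t := {True})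
    trivial |> fun h => by simpa [Set.preimage] using h

lemma measurableSet_localTimeBefore (n : ℕ) (p : (G → ℕ) → Prop) :
    MeasurableSet {x : ℕ → G | p fun z => localTimeBefore walk n z x} :=
  past_le n _ (measurableSet_past_visit n fun _ => p)

lemma measurableSet_past_returnTime_eq (r k : ℕ) :
    MeasurableSet[past G k] {x : ℕ → G | returnTime walk r x = k} := by
  simp_rw [returnTime_eq_iff (walk_zero _)]
  exact measurableSet_past_visit k fun a v => a = 1 ∧ v 1 = r

lemma measurable_returnTime (r : ℕ) : Measurable (returnTime (walk (G := G)) r) := by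
  refine measurable_to_countable' fun y => ?_
  cases y with
  | coe k => exact past_le k _ (measurableSet_past_returnTime_eq r k)
  | top =>
    have : returnTime (walk (G := G)) r ⁻¹' {⊤} =
        (⋃ k : ℕ, {x | returnTime walk r x = k})ᶜ := by
      ext x
      simp only [Set.mem_preimage, Set.mem_singleton_iff, Set.mem_compl_iff, Set.mem_iUnion,
        Set.mem_ofPred_eq]
      rw [← not_iff_not, not_not, ← ne_eq, ENat.ne_top_iff_exists]
      simp_rw [eq_comm]
    rw [this]
    exact (MeasurableSet.iUnion fun k => past_le k _ (measurableSet_past_returnTime_eq r k)).compl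

end Measurability

/-! ### Uniqueness of the visit with a given rank -/

section VisitTimes

variable {Ω G : Type*} {S : ℕ → Ω → G} {ω : Ω}

lemma visit_unique {z : G} {r k l : ℕ} (hk : S k ω = z) (hkr : localTimeBefore S k z ω = r)
    (hl : S l ω = z) (hlr : localTimeBefore S l z ω = r) : k = l := by
  classical
  wlog h : k < l generalizing k l
  · rcases (not_lt.1 h).eq_or_lt with h | h
    · exact h.symm
    · exact (this hl hlr hk hkr h).symm
  have h1 := localTimeBefore_mono (S := S) (ω := ω) (Nat.succ_le_of_lt h) z
  rw [localTimeBefore_succ, if_pos hk] at h1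
  omega

lemma existsUnique_visit {z : G} {r n : ℕ} (h : r < localTimeBefore S n z ω) :
    ∃! k, k < n ∧ S k ω = z ∧ localTimeBefore S k z ω = r := by
  obtain ⟨k, hk, hz, hr⟩ := (lt_localTimeBefore_iff n r z).1 h
  exact ⟨k, ⟨hk, hz, hr⟩, fun l hl => visit_unique hl.2.1 hl.2.2 hz hr⟩

end VisitTimes

lemma sum_measure_eq_one_of_existsUnique {α : Type*} [MeasurableSpace α] {ν : Measure α}
    [IsProbabilityMeasure ν] {n : ℕ} {A : ℕ → Set α} (hA : ∀ k, MeasurableSet (A k))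
    (h : ∀ x, ∃! k, k < n ∧ x ∈ A k) : ∑ k ∈ Finset.range n, ν (A k) = 1 := by
  rw [← measure_biUnion_finset _ fun k _ => hA k]
  · rw [← measure_univ (μ := ν)]
    congr 1
    refine Set.eq_univ_of_forall fun x => ?_
    obtain ⟨k, hk, -⟩ := h x
    simp only [Set.mem_iUnion]
    exact ⟨k, Finset.mem_range.2 hk.1, hk.2⟩
  · intro k hk l hl hkl
    refine Set.disjoint_left.2 fun x hxk hxl => hkl ?_
    exact (h x).unique ⟨Finset.mem_range.1 hk, hxk⟩ ⟨Finset.mem_range.1 hl, hxl⟩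

/-- Convolution with p is a triangular system with unit diagonal, hence injective. -/
lemma eq_of_sum_mul_eq {u t p : ℕ → ℝ} (hp : p 0 = 1)
    (h : ∀ n, ∑ k ∈ Finset.range (n + 1), u k * p (n - k) =
      ∑ k ∈ Finset.range (n + 1), t k * p (n - k)) (n : ℕ) : u n = t n := by
  induction n using Nat.strong_induction_on with
  | _ n ih =>
    have hn := h n
    rw [Finset.sum_range_succ, Finset.sum_range_succ, Finset.sum_congr rfl fun k hk => by
      rw [ih k (Finset.mem_range.1 hk)]] at hn
    simpa [hp] using hn

/-! ### Escape and sites counted at their first visit -/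

section WalkEvents

variable {G : Type*} [Group G]

/-- The event that the walk never returns to the identity. -/
def neverReturns (G : Type*) [Group G] : Set (ℕ → G) := {x | ∀ n, 1 ≤ n → walk n x ≠ 1}

lemma localTimeBefore_of_mem_neverReturns {x : ℕ → G} (hx : x ∈ neverReturns G) {n : ℕ}
    (hn : 0 < n) : localTimeBefore walk n 1 x = 1 := by
  have h1 : 0 < localTimeBefore walk n 1 x := (localTimeBefore_pos_iff n 1).2 ⟨0, hn, rfl⟩
  have h2 : ¬ 1 < localTimeBefore walk n 1 x := by
    rw [← returnTime_lt_iff (walk_zero x), returnTime_one_lt_iff]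
    rintro ⟨k, -, hk, hk1⟩
    exact hx k hk hk1
  omega

lemma setOf_lt_localTimeBefore (n r : ℕ) :
    {x : ℕ → G | r < localTimeBefore walk n 1 x} =
      ⋃ k ∈ Finset.range n, {x | returnTime walk r x = k} := by
  ext x
  simp only [Set.mem_ofPred_eq, Set.mem_iUnion, Finset.mem_range, exists_prop,
    returnTime_eq_iff (walk_zero x), lt_localTimeBefore_iff]

/-- Each i counted on the left is a first visit, so distinct i give distinct sites, and each such
site has r + 1 visits before n. -/
lemma sum_indicator_le_multipleRange (n r : ℕ) (x : ℕ → G) :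
    ∑ i ∈ Finset.range n,
      ({x | localTimeBefore walk i (walk i x) x = 0} ∩
        shift i ⁻¹' {x | localTimeBefore walk (n - i) 1 x = r + 1}).indicator
          (fun _ => (1 : ℝ≥0∞)) x ≤ (multipleRange walk n (r + 1) x : ℝ≥0∞) := by
  classical
  simp only [Set.indicator_apply, Finset.sum_boole]
  set I := (Finset.range n).filter fun i => x ∈ ({x | localTimeBefore walk i (walk i x) x = 0} ∩
        shift i ⁻¹' {x | localTimeBefore walk (n - i) 1 x = r + 1}) with hI
  have hinj : Set.InjOn (fun i => walk i x) (I : Set ℕ) := by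
    intro i hi j hj hij
    have hi := (Finset.mem_filter.1 hi).2.1
    have hj := (Finset.mem_filter.1 hj).2.1
    refine visit_unique (S := walk) (z := walk j x) hij ?_ rfl hj
    have hij : walk i x = walk j x := hij
    rw [← hij]
    exact hi
  have hsub : (fun i => walk i x) '' (I : Set ℕ) ⊆
      {z | localTimeBefore walk n z x = (r + 1 : ℕ)} := by
    rintro _ ⟨i, hi, rfl⟩
    obtain ⟨hi, h1, h2⟩ := Finset.mem_filter.1 hi
    obtain ⟨l, rfl⟩ := Nat.exists_eq_add_of_le (Finset.mem_range.1 hi).le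
    have h3 := localTimeBefore_walk_add i l x
    simp only [Set.mem_ofPred_eq, Set.mem_preimage, Nat.add_sub_cancel_left] at h1 h2
    rw [h1, h2, zero_add] at h3
    exact h3
  have h := Set.encard_le_encard hsub
  rw [hinj.encard_image, Set.encard_coe_eq_coe_finsetCard] at h
  have h' := ENat.toENNReal_le.2 h
  rwa [ENat.toENNReal_coe] at h'

end WalkEvents

/-! ### Independent increments and the Markov property -/

section Law

variable {G : Type*} [MeasurableSpace G] (μ : Measure G) [IsProbabilityMeasure μ]

/-- The law of the sequence of increments of the walk with step distribution `μ`. -/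
abbrev incrementLaw : Measure (ℕ → G) := Measure.infinitePi fun _ : ℕ => μ

lemma map_shift_incrementLaw (k : ℕ) : (incrementLaw μ).map (shift k) = incrementLaw μ :=
  Measure.map_infinitePi_infinitePi_of_inj (P := fun _ : ℕ => μ) (add_right_injective k)

/-- The Markov property: the increments before k are independent of those from k on, and the latter
have the original law. -/
lemma measure_past_inter_shift {k : ℕ} {A B : Set (ℕ → G)} (hA : MeasurableSet[past G k] A)
    (hB : MeasurableSet B) :
    incrementLaw μ (A ∩ shift k ⁻¹' B) = incrementLaw μ A * incrementLaw μ B := by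
  have hind : iIndep (fun i => MeasurableSpace.comap (fun x : ℕ → G => x i) inferInstance)
      (incrementLaw μ) :=
    iIndepFun_infinitePi (P := fun _ : ℕ => μ) (X := fun _ => id) fun _ => measurable_id
  have h := indep_iSup_of_disjoint (fun i => (measurable_pi_apply i).comap_le) hind
    (S := Set.Iio k) (T := Set.Ici k) (Set.Iio_disjoint_Ici le_rfl)
  rw [Indep_iff] at h
  rw [h A _ hA, ← map_shift_incrementLaw μ k,
    Measure.map_apply (measurable_shift k) hB, map_shift_incrementLaw]
  have hm : @Measurable _ _ (⨆ i ∈ Set.Ici k,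
      MeasurableSpace.comap (fun x : ℕ → G => x i) inferInstance) _ (shift k) := by
    refine (@measurable_pi_iff _ _ _ (_) _ _).2 fun i => ?_
    refine Measurable.mono (comap_measurable fun x : ℕ → G => x (k + i)) ?_ le_rfl
    exact le_iSup₂_of_le (f := fun (i : ℕ) (_ : i ∈ Set.Ici k) =>
      MeasurableSpace.comap (fun x : ℕ → G => x i) inferInstance) (k + i)
      (Nat.le_add_right k i) le_rfl
  exact hm hB

lemma setLIntegral_comp_shift {k : ℕ} {A : Set (ℕ → G)} (hA : MeasurableSet[past G k] A)
    {φ : (ℕ → G) → ℝ≥0∞} (hφ : Measurable φ) :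
    ∫⁻ x in A, φ (shift k x) ∂(incrementLaw μ) =
      incrementLaw μ A * ∫⁻ x, φ x ∂(incrementLaw μ) := by
  have h : ((incrementLaw μ).restrict A).map (shift k) =
      (incrementLaw μ A) • incrementLaw μ := by
    ext B hB
    rw [Measure.map_apply (measurable_shift k) hB,
      Measure.restrict_apply (measurable_shift k hB), Set.inter_comm,
      measure_past_inter_shift μ hA hB]
    rfl
  rw [← lintegral_map hφ (measurable_shift k), h, lintegral_smul_measure, smul_eq_mul]

/-! ### Renewal identities and the bound for the multiple range -/

variable [Group G] [Countable G] [MeasurableSingletonClass G]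

lemma measurableSet_neverReturns : MeasurableSet (neverReturns G) := by
  have : neverReturns G = ⋂ n : ℕ, {x | 1 ≤ n → walk n x ≠ 1} := by
    ext x
    simp [neverReturns]
  rw [this]
  exact MeasurableSet.iInter fun n =>
    past_le n _ (measurableSet_past_visit n fun a _ => 1 ≤ n → a ≠ 1)

/-- Partition according to the time k of the first visit to the position occupied at time n. -/
lemma sum_firstVisit_mul_return (n : ℕ) :
    ∑ k ∈ Finset.range (n + 1),
      incrementLaw μ {x | localTimeBefore walk k (walk k x) x = 0} *
        incrementLaw μ {x | walk (n - k) x = 1} = 1 := by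
  rw [Finset.sum_congr rfl fun k _ => (measure_past_inter_shift μ
    (measurableSet_past_visit k fun a v => v a = 0)
    (past_le _ _ (measurableSet_past_visit (n - k) fun a _ => a = 1))).symm]
  refine sum_measure_eq_one_of_existsUnique (fun k =>
    (past_le _ _ (measurableSet_past_visit k fun a v => v a = 0)).inter (measurable_shift k
    (past_le _ _ (measurableSet_past_visit (n - k) fun a _ => a = 1)))) fun x => ?_
  refine (existsUnique_congr fun k => ?_).1 (existsUnique_visit (S := walk) (ω := x) (r := 0)
    ((localTimeBefore_pos_iff (n + 1) (walk n x)).2 ⟨n, by omega, rfl⟩))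
  refine and_congr_right fun hk => ?_
  obtain ⟨l, rfl⟩ := Nat.exists_eq_add_of_le (Nat.lt_succ_iff.1 hk)
  simp only [Set.mem_inter_iff, Set.mem_preimage, Set.mem_ofPred_eq, walk_add,
    Nat.add_sub_cancel_left, left_eq_mul]
  constructor
  · rintro ⟨h1, h2⟩
    rw [h1, mul_one] at h2
    exact ⟨h2, h1⟩
  · rintro ⟨h1, h2⟩
    rw [h2, mul_one]
    exact ⟨rfl, h1⟩

/-- Partition according to the last visit to the identity up to time n. -/
lemma sum_noReturn_mul_return (n : ℕ) :
    ∑ k ∈ Finset.range (n + 1),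
      incrementLaw μ {x | localTimeBefore walk (k + 1) 1 x = 1} *
        incrementLaw μ {x | walk (n - k) x = 1} = 1 := by
  -- After reversing the sum, k is the time of the last visit and the event of no further return
  -- lies in its future.
  rw [← Finset.sum_range_reflect]
  refine Eq.trans (Finset.sum_congr rfl (g := fun k => incrementLaw μ ({x | walk k x = 1} ∩
    shift k ⁻¹' {x | localTimeBefore walk (n + 1 - k) 1 x = 1})) fun k hk => ?_)
    (sum_measure_eq_one_of_existsUnique (fun k =>
      (past_le _ _ (measurableSet_past_visit k fun a v => a = 1)).inter (measurable_shift k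
      (measurableSet_localTimeBefore (n + 1 - k) fun v => v 1 = 1))) fun x => ?_)
  · have hk := Finset.mem_range.1 hk
    rw [mul_comm, show n + 1 - 1 - k + 1 = n + 1 - k by omega,
      show n - (n + 1 - 1 - k) = k by omega]
    exact (measure_past_inter_shift μ (measurableSet_past_visit k fun a _ => a = 1)
      (measurableSet_localTimeBefore (n + 1 - k) fun v => v 1 = 1)).symm
  have hpos : 0 < localTimeBefore walk (n + 1) 1 x :=
    (localTimeBefore_pos_iff (n + 1) _).2 ⟨0, by omega, rfl⟩
  -- The last visit is the one preceded by all visits but one.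
  refine (existsUnique_congr fun k => ?_).1 (existsUnique_visit (S := walk) (ω := x)
    (Nat.sub_lt hpos Nat.one_pos))
  refine and_congr_right fun hk => ?_
  obtain ⟨l, hl⟩ := Nat.exists_eq_add_of_le hk.le
  simp only [Set.mem_inter_iff, Set.mem_preimage, Set.mem_ofPred_eq]
  refine and_congr_right fun h1 => ?_
  have h := localTimeBefore_walk_add k l x
  rw [h1, ← hl] at h
  rw [show n + 1 - k = l by omega]
  omega

/-- Usually seen by time reversal; here both sequences have convolution 1 with the return
probabilities, and so they agree. -/
lemma measure_firstVisit (n : ℕ) :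
    incrementLaw μ {x | localTimeBefore walk n (walk n x) x = 0} =
      incrementLaw μ {x | localTimeBefore walk (n + 1) 1 x = 1} := by
  have key := eq_of_sum_mul_eq
    (u := fun n => (incrementLaw μ).real {x | localTimeBefore walk n (walk n x) x = 0})
    (t := fun n => (incrementLaw μ).real {x | localTimeBefore walk (n + 1) 1 x = 1})
    (p := fun n => (incrementLaw μ).real {x | walk n x = 1}) (by simp) (fun n => by
      have h := congrArg ENNReal.toReal
        ((sum_firstVisit_mul_return μ n).trans (sum_noReturn_mul_return μ n).symm)
      rw [ENNReal.toReal_sum fun _ _ => by finiteness,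
        ENNReal.toReal_sum fun _ _ => by finiteness] at h
      simpa only [ENNReal.toReal_mul, ← measureReal_def] using h) n
  exact (measureReal_eq_measureReal_iff).1 key

lemma measure_neverReturns_le_firstVisit (n : ℕ) :
    incrementLaw μ (neverReturns G) ≤
      incrementLaw μ {x | localTimeBefore walk n (walk n x) x = 0} := by
  rw [measure_firstVisit]
  exact measure_mono fun x hx => localTimeBefore_of_mem_neverReturns hx n.succ_pos

/-- If τ_r = k < n and the walk restarted at k never returns, then there are exactly r + 1 visits
before n. The events for different k are disjoint. -/
lemma measure_neverReturns_mul_le (n r : ℕ) :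
    incrementLaw μ (neverReturns G) * incrementLaw μ {x | r < localTimeBefore walk n 1 x} ≤
      incrementLaw μ {x | localTimeBefore walk n 1 x = r + 1} := by
  rw [setOf_lt_localTimeBefore]
  calc _ ≤ incrementLaw μ (neverReturns G) *
        ∑ k ∈ Finset.range n, incrementLaw μ {x | returnTime walk r x = k} := by
        gcongr
        exact measure_biUnion_finset_le _ _
    _ = ∑ k ∈ Finset.range n,
        incrementLaw μ ({x | returnTime walk r x = k} ∩ shift k ⁻¹' neverReturns G) := by
        rw [Finset.mul_sum]
        refine Finset.sum_congr rfl fun k _ => ?_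
        rw [measure_past_inter_shift μ (measurableSet_past_returnTime_eq r k)
          measurableSet_neverReturns, mul_comm]
    _ = incrementLaw μ (⋃ k ∈ Finset.range n,
        ({x | returnTime walk r x = k} ∩ shift k ⁻¹' neverReturns G)) := by
        refine (measure_biUnion_finset ?_ fun k _ =>
          (past_le _ _ (measurableSet_past_returnTime_eq r k)).inter
            (measurable_shift k measurableSet_neverReturns)).symm
        intro k _ l _ hkl
        refine Set.disjoint_left.2 fun x hk hl => hkl ?_
        exact_mod_cast hk.1.symm.trans hl.1
    _ ≤ _ := by
        refine measure_mono (Set.iUnion₂_subset ?_)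
        rintro k hk x ⟨h, hx⟩
        obtain ⟨h1, h2⟩ := (returnTime_eq_iff (walk_zero x) r k).1 h
        have hk := Finset.mem_range.1 hk
        obtain ⟨l, rfl⟩ := Nat.exists_eq_add_of_le hk.le
        have h3 := localTimeBefore_walk_add k l x
        rw [h1, h2, localTimeBefore_of_mem_neverReturns hx (by omega)] at h3
        exact h3

lemma lintegral_natCast_sub_returnTime (μ : Measure G) (n r : ℕ) :
    ∫⁻ x, ((n : ℝ≥0∞) - (returnTime walk r x : ℝ≥0∞)) ∂(incrementLaw μ) =
      ∑ m ∈ Finset.range n, incrementLaw μ {x | r < localTimeBefore walk (m + 1) 1 x} := by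
  simp_rw [natCast_sub_returnTime_eq_sum (walk_zero _)]
  rw [lintegral_finsetSum _ fun m _ => measurable_const.indicator
    (measurableSet_localTimeBefore (m + 1) fun v => r < v 1)]
  refine Finset.sum_congr rfl fun m _ => ?_
  exact lintegral_indicator_one (measurableSet_localTimeBefore (m + 1) fun v => r < v 1)

theorem mul_lintegral_returnTime_le_multipleRange (n r : ℕ) :
    incrementLaw μ (neverReturns G) ^ 2 *
        ∫⁻ x, ((n : ℝ≥0∞) - (returnTime walk r x : ℝ≥0∞)) ∂(incrementLaw μ) ≤
      ∫⁻ x, (multipleRange walk n (r + 1) x : ℝ≥0∞) ∂(incrementLaw μ) := by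
  have hm : ∀ i, MeasurableSet ({x : ℕ → G | localTimeBefore walk i (walk i x) x = 0} ∩
        shift i ⁻¹' {x | localTimeBefore walk (n - i) 1 x = r + 1}) := fun i =>
    (past_le _ _ (measurableSet_past_visit i fun a v => v a = 0)).inter
      (measurable_shift i (measurableSet_localTimeBefore (n - i) fun v => v 1 = r + 1))
  refine le_trans ?_ (lintegral_mono (sum_indicator_le_multipleRange n r))
  rw [lintegral_finsetSum _ fun i _ => measurable_const.indicator (hm i),
    -- Reversal pairs a first visit at time i with the horizon n - i.
    lintegral_natCast_sub_returnTime, Finset.mul_sum, ← Finset.sum_range_reflect]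
  refine Finset.sum_le_sum fun i hi => ?_
  have hi := Finset.mem_range.1 hi
  rw [lintegral_indicator (hm i), setLIntegral_const, one_mul, measure_past_inter_shift μ
    (measurableSet_past_visit i fun a v => v a = 0)
    (measurableSet_localTimeBefore (n - i) fun v => v 1 = r + 1),
    show n - 1 - i + 1 = n - i by omega, sq, mul_assoc]
  exact mul_le_mul' (measure_neverReturns_le_firstVisit μ i)
    (measure_neverReturns_mul_le μ (n - i) r)

/-! ### Distribution and mean of the return times -/

lemma lintegral_eq_tsum_returnTime (μ : Measure G) (r : ℕ) {F : (ℕ → G) → ℝ≥0∞}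
    (hF : ∀ x, returnTime walk r x = ⊤ → F x = 0) :
    ∫⁻ x, F x ∂(incrementLaw μ) =
      ∑' i : ℕ, ∫⁻ x in {x | returnTime walk r x = i}, F x ∂(incrementLaw μ) := by
  rw [← lintegral_iUnion
    (fun i => past_le i _ (measurableSet_past_returnTime_eq r i)) (fun i j hij => ?_) F]
  · refine (setLIntegral_eq_of_support_subset fun x hx => ?_).symm
    obtain ⟨i, hi⟩ := ENat.ne_top_iff_exists.1 fun h => hx (hF x h)
    exact Set.mem_iUnion.2 ⟨i, hi.symm⟩
  · refine Set.disjoint_left.2 fun x hi hj => hij ?_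
    exact_mod_cast (show returnTime walk r x = i from hi).symm.trans hj

lemma lintegral_comp_returnTime (μ : Measure G) (r : ℕ) {Ψ : ℕ∞ → ℝ≥0∞} (hΨ : Ψ ⊤ = 0) :
    ∫⁻ x, Ψ (returnTime walk r x) ∂(incrementLaw μ) =
      ∑' i : ℕ, incrementLaw μ {x | returnTime walk r x = i} * Ψ i := by
  rw [lintegral_eq_tsum_returnTime μ r fun x hx => by rw [hx, hΨ]]
  refine tsum_congr fun i => ?_
  rw [mul_comm, ← setLIntegral_const]
  refine setLIntegral_congr_fun (past_le i _ (measurableSet_past_returnTime_eq r i))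
    fun x hx => ?_
  rw [show returnTime walk r x = i from hx]

/-- The strong Markov property at the r-th return, obtained by summing the Markov property over its
finite values. -/
lemma lintegral_comp_returnTime_succ (r : ℕ) {Ψ : ℕ∞ → ℝ≥0∞} (hΨ : Ψ ⊤ = 0) :
    ∫⁻ x, Ψ (returnTime walk (r + 1) x) ∂(incrementLaw μ) =
      ∑' i : ℕ, incrementLaw μ {x | returnTime walk r x = i} *
        ∫⁻ x, Ψ (i + returnTime walk 1 x) ∂(incrementLaw μ) := by
  rw [lintegral_eq_tsum_returnTime μ r]
  · refine tsum_congr fun i => ?_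
    rw [← setLIntegral_comp_shift μ (measurableSet_past_returnTime_eq r i)
      (φ := fun x => Ψ (i + returnTime walk 1 x))
      ((Measurable.of_discrete (f := fun t : ℕ∞ => Ψ (i + t))).comp (measurable_returnTime 1))]
    refine setLIntegral_congr_fun (past_le i _ (measurableSet_past_returnTime_eq r i))
      fun x hx => ?_
    rw [returnTime_succ_eq_add hx]
  · intro x hx
    suffices returnTime walk (r + 1) x = ⊤ by rw [this, hΨ]
    by_contra h
    obtain ⟨n, hn⟩ := ENat.ne_top_iff_exists.1 h
    have h1 := (returnTime_lt_iff (walk_zero x) (r + 1) (n + 1)).1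
      (by rw [← hn]; norm_cast; omega)
    have h2 := (returnTime_lt_iff (walk_zero x) r (n + 1)).2 (by omega)
    rw [hx] at h2
    exact not_top_lt h2

lemma measurableSet_returnTime_lt_top (r : ℕ) :
    MeasurableSet {x : ℕ → G | returnTime walk r x < ⊤} :=
  measurable_returnTime r (MeasurableSet.of_discrete (s := Set.Iio ⊤))

lemma lintegral_returnTime_ne_top (μ : Measure G) (r : ℕ) :
    ∫⁻ x, (if returnTime walk r x = ⊤ then 0 else 1) ∂(incrementLaw μ) =
      incrementLaw μ {x | returnTime walk r x < ⊤} := by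
  classical
  rw [← lintegral_indicator_one (measurableSet_returnTime_lt_top r)]
  congr with x
  by_cases h : returnTime walk r x = ⊤ <;> simp [h, lt_top_iff_ne_top]

lemma tsum_returnTime_eq (μ : Measure G) (r : ℕ) :
    ∑' i : ℕ, incrementLaw μ {x | returnTime walk r x = i} =
      incrementLaw μ {x | returnTime walk r x < ⊤} := by
  rw [← lintegral_returnTime_ne_top,
    lintegral_comp_returnTime μ r (Ψ := fun t => if t = ⊤ then 0 else 1) (by simp)]
  simp

lemma measure_returnTime_lt_top (r : ℕ) :
    incrementLaw μ {x | returnTime walk r x < ⊤} =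
      incrementLaw μ {x | returnTime walk 1 x < ⊤} ^ r := by
  induction r with
  | zero => simp [returnTime]
  | succ r ih =>
    rw [← lintegral_returnTime_ne_top, lintegral_comp_returnTime_succ μ r
      (Ψ := fun t => if t = ⊤ then 0 else 1) (by simp)]
    simp only [ENat.add_eq_top, ENat.natCast_ne_top, false_or]
    rw [lintegral_returnTime_ne_top, ENNReal.tsum_mul_right, tsum_returnTime_eq, ih, pow_succ]

/-- The contribution to the mean of the `r`-th return time of the event that it is finite. -/
def meanReturnTime (r : ℕ) : ℝ≥0∞ :=
  ∫⁻ x, (if returnTime walk r x = ⊤ then 0 else (returnTime walk r x : ℝ≥0∞)) ∂(incrementLaw μ)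

lemma meanReturnTime_succ (r : ℕ) :
    meanReturnTime μ (r + 1) =
      meanReturnTime μ r * incrementLaw μ {x | returnTime walk 1 x < ⊤} +
        incrementLaw μ {x | returnTime walk 1 x < ⊤} ^ r * meanReturnTime μ 1 := by
  have h : ∀ i : ℕ, ∫⁻ x, (if (i : ℕ∞) + returnTime walk 1 x = ⊤ then 0 else
      (((i : ℕ∞) + returnTime walk 1 x : ℕ∞) : ℝ≥0∞)) ∂(incrementLaw μ) =
      i * incrementLaw μ {x | returnTime walk 1 x < ⊤} + meanReturnTime μ 1 := by
    intro i
    rw [← lintegral_returnTime_ne_top, meanReturnTime, ← lintegral_const_mul,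
      ← lintegral_add_left]
    · congr with x
      by_cases hx : returnTime walk 1 x = ⊤ <;> simp [hx]
    · exact ((Measurable.of_discrete (f := fun t : ℕ∞ => if t = ⊤ then (0 : ℝ≥0∞) else 1)).comp
        (measurable_returnTime 1)).const_mul _
    · exact (Measurable.of_discrete (f := fun t : ℕ∞ => if t = ⊤ then (0 : ℝ≥0∞) else 1)).comp
        (measurable_returnTime 1)
  rw [meanReturnTime, lintegral_comp_returnTime_succ μ r
    (Ψ := fun t => if t = ⊤ then 0 else (t : ℝ≥0∞)) (by simp)]
  simp only [h, mul_add]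
  rw [ENNReal.tsum_add, ENNReal.tsum_mul_right, tsum_returnTime_eq,
    measure_returnTime_lt_top μ r]
  congr 1
  rw [meanReturnTime, lintegral_comp_returnTime μ r
    (Ψ := fun t => if t = ⊤ then 0 else (t : ℝ≥0∞)) (by simp), ← ENNReal.tsum_mul_right]
  simp [mul_assoc]

lemma meanReturnTime_le {M : ℝ≥0∞}
    (hM : meanReturnTime μ 1 ≤ incrementLaw μ {x | returnTime walk 1 x < ⊤} * M) (r : ℕ) :
    meanReturnTime μ r ≤ r * (incrementLaw μ {x | returnTime walk 1 x < ⊤} ^ r * M) := by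
  induction r with
  | zero => simp [meanReturnTime, returnTime]
  | succ r ih =>
    rw [meanReturnTime_succ]
    set q := incrementLaw μ {x | returnTime walk 1 x < ⊤}
    calc _ ≤ r * (q ^ r * M) * q + q ^ r * (q * M) := by gcongr
      _ = _ := by push_cast; ring

/-- Integrate n ≤ max(n - τ_r, 0) + τ_r over the event that τ_r is finite. The additive form avoids
truncated subtraction. -/
theorem mul_pow_le_lintegral_returnTime {M : ℝ≥0∞}
    (hM : meanReturnTime μ 1 ≤ incrementLaw μ {x | returnTime walk 1 x < ⊤} * M) (n r : ℕ) :
    n * incrementLaw μ {x | returnTime walk 1 x < ⊤} ^ r ≤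
      ∫⁻ x, ((n : ℝ≥0∞) - (returnTime walk r x : ℝ≥0∞)) ∂(incrementLaw μ) +
        r * (incrementLaw μ {x | returnTime walk 1 x < ⊤} ^ r * M) := by
  refine le_trans ?_ (add_le_add_right (meanReturnTime_le μ hM r) _)
  rw [← measure_returnTime_lt_top, ← lintegral_returnTime_ne_top, meanReturnTime,
    ← lintegral_const_mul, ← lintegral_add_left]
  · refine lintegral_mono fun x => ?_
    by_cases hx : returnTime walk r x = ⊤
    · simp [hx]
    · simp [hx, le_tsub_add]
  · exact (Measurable.of_discrete (f := fun t : ℕ∞ => (n : ℝ≥0∞) - (t : ℝ≥0∞))).comp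
      (measurable_returnTime r)
  · exact (Measurable.of_discrete (f := fun t : ℕ∞ => if t = ⊤ then (0 : ℝ≥0∞) else 1)).comp
      (measurable_returnTime r)

/-- A site with more than m visits makes the walk restarted at its first visit return m times; a
union bound over that first visit concludes. -/
theorem measure_exists_lt_localTimeBefore_le (n m : ℕ) :
    incrementLaw μ {x | ∃ z, m < localTimeBefore walk n z x} ≤
      n * incrementLaw μ {x | returnTime walk 1 x < ⊤} ^ m := by
  have hsub : {x : ℕ → G | ∃ z, m < localTimeBefore walk n z x} ⊆
      ⋃ i ∈ Finset.range n, shift i ⁻¹' {x | returnTime walk m x < ⊤} := by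
    rintro x ⟨z, hz⟩
    obtain ⟨i, hi, rfl, hi0⟩ := (lt_localTimeBefore_iff n 0 z).1 ((Nat.zero_le m).trans_lt hz)
    obtain ⟨l, rfl⟩ := Nat.exists_eq_add_of_le hi.le
    rw [localTimeBefore_walk_add, hi0, zero_add, ← returnTime_lt_iff (walk_zero _)] at hz
    simp only [Set.mem_iUnion]
    exact ⟨i, Finset.mem_range.2 hi, hz.trans (ENat.natCast_lt_top l)⟩
  refine (measure_mono hsub).trans ((measure_biUnion_finset_le _ _).trans ?_)
  rw [← measure_returnTime_lt_top]
  have h : ∀ i, incrementLaw μ (shift i ⁻¹' {x | returnTime walk m x < ⊤}) =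
      incrementLaw μ {x | returnTime walk m x < ⊤} := fun i => by
    rw [← Measure.map_apply (measurable_shift i) (measurableSet_returnTime_lt_top m),
      map_shift_incrementLaw]
  simp only [h, Finset.sum_const, Finset.card_range, nsmul_eq_mul, le_refl]

lemma measure_neverReturns_add :
    incrementLaw μ (neverReturns G) + incrementLaw μ {x | returnTime walk 1 x < ⊤} = 1 := by
  have h : {x : ℕ → G | returnTime walk 1 x < ⊤} = (neverReturns G)ᶜ := by
    ext x
    simp [neverReturns, returnTime_one_lt_top_iff]
  rw [h, measure_add_measure_compl measurableSet_neverReturns, measure_univ]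

end Law

/-! ### Uniform integrability and vanishing parts -/

section UniformIntegrability

variable {Ω : Type*} [MeasurableSpace Ω] {P : Measure Ω} [IsFiniteMeasure P]

/-- If `Y n` converges in mean square, `|Z m| ≤ |Y (k m)|` and `P(Z m ≠ 0) → 0`, then `Z m`
converges to zero in mean square. -/
lemma tendsto_eLpNorm_zero_of_le_of_measure_ne_zero {Y Z : ℕ → Ω → ℝ} {g : Ω → ℝ} (k : ℕ → ℕ)
    (hY : ∀ n, MemLp (Y n) 2 P) (hg : MemLp g 2 P)
    (h : Tendsto (fun n => eLpNorm (fun ω => Y n ω - g ω) 2 P) atTop (𝓝 0))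
    (hZ : ∀ m, AEStronglyMeasurable (Z m) P) (hle : ∀ m ω, |Z m ω| ≤ |Y (k m) ω|)
    (h0 : Tendsto (fun m => P {ω | Z m ω ≠ 0}) atTop (𝓝 0)) :
    Tendsto (fun m => eLpNorm (Z m) 2 P) atTop (𝓝 0) := by
  have hUI := unifIntegrable_of_tendsto_Lp (by norm_num) (by norm_num) hY hg h
  have hUIZ : UnifIntegrable Z 2 P := by
    intro ε hε
    obtain ⟨δ, hδ, H⟩ := hUI hε
    refine ⟨δ, hδ, fun m s hs hsδ => le_trans ?_ (H (k m) s hs hsδ)⟩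
    refine eLpNorm_mono fun ω => ?_
    by_cases hω : ω ∈ s <;> simp [hω, hle m ω]
  have hmeas : TendstoInMeasure P Z atTop (0 : Ω → ℝ) := by
    intro ε hε
    refine tendsto_of_tendsto_of_tendsto_of_le_of_le tendsto_const_nhds h0 (fun _ => zero_le)
      fun m => measure_mono fun ω hω hzero => ?_
    simp only [Set.mem_ofPred_eq, hzero, Pi.zero_apply, edist_self] at hω
    exact absurd hω (not_le.2 hε)
  have := tendsto_Lp_finite_of_tendstoInMeasure (p := 2) (by norm_num) (by norm_num) hZ
    MemLp.zero hUIZ hmeas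
  simpa using this

end UniformIntegrability

/-! ### Local time functionals and the multiple range -/

section LocalTimeSum

variable {Ω G : Type*} {S : ℕ → Ω → G} {ω : Ω}

lemma localTimeBefore_le (n : ℕ) (z : G) : localTimeBefore S n z ω ≤ n := by
  classical
  unfold localTimeBefore
  exact (Finset.card_filter_le _ _).trans (Finset.card_range n).le

open Classical in
lemma localTimeBefore_eq_zero_of_notMem {n : ℕ} {z : G}
    (hz : z ∉ (Finset.range n).image fun i => S i ω) : localTimeBefore S n z ω = 0 := by
  by_contra h
  obtain ⟨i, hi, rfl⟩ := (localTimeBefore_pos_iff n z).1 (Nat.pos_of_ne_zero h)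
  exact hz (Finset.mem_image_of_mem _ (Finset.mem_range.2 hi))

open Classical in
lemma localTimeSum_eq_sum {f : ℕ → ℝ} (hf : f 0 = 0) (n : ℕ) :
    localTimeSum S f n ω =
      ∑ z ∈ (Finset.range n).image (fun i => S i ω), f (localTimeBefore S n z ω) :=
  tsum_eq_sum fun z hz => by rw [localTimeBefore_eq_zero_of_notMem hz, hf]

lemma abs_localTimeSum_le {f : ℕ → ℝ} (hf : f 0 = 0) (n : ℕ) :
    |localTimeSum S f n ω| ≤ n * ∑ j ∈ Finset.range (n + 1), |f j| := by
  classical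
  rw [localTimeSum_eq_sum hf]
  have hC : ∀ z, |f (localTimeBefore S n z ω)| ≤ ∑ j ∈ Finset.range (n + 1), |f j| := fun z =>
    Finset.single_le_sum (f := fun j => |f j|) (fun _ _ => abs_nonneg _)
      (Finset.mem_range.2 (Nat.lt_succ_of_le (localTimeBefore_le n z)))
  refine (Finset.abs_sum_le_sum_abs _ _).trans
    ((Finset.sum_le_card_nsmul _ _ _ fun z _ => hC z).trans ?_)
  rw [nsmul_eq_mul]
  refine mul_le_mul_of_nonneg_right ?_ (Finset.sum_nonneg fun _ _ => abs_nonneg _)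
  exact_mod_cast Finset.card_image_le.trans (Finset.card_range n).le

lemma localTimeSum_le_localTimeSum {f h : ℕ → ℝ} (hf : f 0 = 0) (hh : h 0 = 0)
    (hle : ∀ j, h j ≤ f j) (n : ℕ) : localTimeSum S h n ω ≤ localTimeSum S f n ω := by
  classical
  rw [localTimeSum_eq_sum hf, localTimeSum_eq_sum hh]
  exact Finset.sum_le_sum fun z _ => hle _

lemma localTimeSum_nonneg {f : ℕ → ℝ} (hf : ∀ j, 0 ≤ f j) (n : ℕ) :
    0 ≤ localTimeSum S f n ω :=
  tsum_nonneg fun _ => hf _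

open Classical in
lemma multipleRange_eq_card (n : ℕ) {j : ℕ} (hj : j ≠ 0) :
    multipleRange S n j ω = ((((Finset.range n).image fun i => S i ω).filter
      fun z => localTimeBefore S n z ω = j).card : ℕ∞) := by
  rw [← Set.encard_coe_eq_coe_finsetCard, multipleRange]
  congr 1
  ext z
  simp only [Set.mem_ofPred_eq, Finset.coe_filter]
  refine ⟨fun h => ⟨?_, h⟩, fun h => h.2⟩
  by_contra hz
  exact hj (h ▸ localTimeBefore_eq_zero_of_notMem hz)

/-- For nonnegative terms the square of a sum dominates the sum of squares; the squares are grouped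
by the value of the local time. -/
lemma sum_mul_multipleRange_le {h : ℕ → ℝ} (hh : h 0 = 0) (hnn : ∀ j, 0 ≤ h j) (n : ℕ)
    {T : Finset ℕ} (hT : 0 ∉ T) :
    ∑ j ∈ T, ENNReal.ofReal (h j ^ 2) * (multipleRange S n j ω : ℝ≥0∞) ≤
      ENNReal.ofReal (localTimeSum S h n ω ^ 2) := by
  classical
  set F := (Finset.range n).image fun i => S i ω with hF
  have h1 : ∑ j ∈ T, ENNReal.ofReal (h j ^ 2) * (multipleRange S n j ω : ℝ≥0∞) =
      ENNReal.ofReal (∑ j ∈ T, h j ^ 2 *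
        ((F.filter fun z => localTimeBefore S n z ω = j).card : ℝ)) := by
    rw [ENNReal.ofReal_sum_of_nonneg fun j _ => by positivity]
    refine Finset.sum_congr rfl fun j hj => ?_
    rw [multipleRange_eq_card n fun h => hT (h ▸ hj), ENat.toENNReal_coe,
      ENNReal.ofReal_mul (sq_nonneg _), ENNReal.ofReal_natCast]
  rw [h1]
  refine ENNReal.ofReal_le_ofReal ?_
  calc ∑ j ∈ T, h j ^ 2 * ((F.filter fun z => localTimeBefore S n z ω = j).card : ℝ)
      = ∑ j ∈ T, ∑ z ∈ F with localTimeBefore S n z ω = j, h (localTimeBefore S n z ω) ^ 2 := by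
        refine Finset.sum_congr rfl fun j _ => ?_
        rw [Finset.sum_congr rfl fun z hz => by rw [(Finset.mem_filter.1 hz).2],
          Finset.sum_const, nsmul_eq_mul, mul_comm]
    _ ≤ ∑ z ∈ F, h (localTimeBefore S n z ω) ^ 2 :=
        Finset.sum_fiberwise_le_sum_of_sum_fiber_nonneg fun j _ =>
          Finset.sum_nonneg fun z _ => sq_nonneg _
    _ ≤ (∑ z ∈ F, h (localTimeBefore S n z ω)) ^ 2 :=
        Finset.sum_sq_le_sq_sum_of_nonneg fun z _ => hnn _
    _ = localTimeSum S h n ω ^ 2 := by rw [localTimeSum_eq_sum hh]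

lemma exists_lt_localTimeBefore_of_localTimeSum_ne_zero {h : ℕ → ℝ} {m n : ℕ}
    (hh : ∀ j ≤ m, h j = 0) (hne : localTimeSum S h n ω ≠ 0) :
    ∃ z, m < localTimeBefore S n z ω := by
  by_contra! hle
  exact hne (by simp [localTimeSum, hh _ (hle _)])

end LocalTimeSum

/-! ### Transfer to an arbitrary random walk -/

section Transfer

variable {Ω G : Type*} [Group G] {S : ℕ → Ω → G} {ω : Ω} {x : ℕ → G}

lemma localTimeBefore_eq_of_forall (h : ∀ n, S n ω = walk n x) (n : ℕ) (z : G) :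
    localTimeBefore S n z ω = localTimeBefore walk n z x := by
  classical
  unfold localTimeBefore
  exact congrArg Finset.card (Finset.filter_congr fun i _ => by rw [h])

lemma returnTime_eq_of_forall (h : ∀ n, S n ω = walk n x) (r : ℕ) :
    returnTime S r ω = returnTime walk r x := by
  induction r with
  | zero => rfl
  | succ r ih => simp [returnTime, h, ih]

lemma multipleRange_eq_of_forall (h : ∀ n, S n ω = walk n x) (n j : ℕ) :
    multipleRange S n j ω = multipleRange walk n j x := by
  simp [multipleRange, localTimeBefore_eq_of_forall h]

lemma localTimeSum_eq_of_forall (h : ∀ n, S n ω = walk n x) (f : ℕ → ℝ) (n : ℕ) :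
    localTimeSum S f n ω = localTimeSum walk f n x := by
  simp [localTimeSum, localTimeBefore_eq_of_forall h]

/-- The increments of the process `S`. -/
def increments (S : ℕ → Ω → G) (ω : Ω) (n : ℕ) : G := (S n ω)⁻¹ * S (n + 1) ω

/-- The distribution of the first increment of the process `S`. -/
def stepLaw [MeasurableSpace Ω] [MeasurableSpace G] (S : ℕ → Ω → G) (P : Measure Ω) :
    Measure G := P.map fun ω => increments S ω 0

lemma eq_walk_increments (h0 : S 0 ω = 1) (n : ℕ) : S n ω = walk n (increments S ω) := by
  induction n with
  | zero => exact h0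
  | succ n ih => rw [walk, ← ih, increments, mul_inv_cancel_left]

lemma escapeProb_nonneg [MeasurableSpace Ω] {P : Measure Ω} : 0 ≤ escapeProb S P :=
  measureReal_nonneg

lemma escapeProb_le_one [MeasurableSpace Ω] {P : Measure Ω} [IsProbabilityMeasure P] :
    escapeProb S P ≤ 1 :=
  measureReal_le_one

namespace IsRandomWalk

variable [MeasurableSpace Ω] {P : Measure Ω} [MeasurableSpace G]

lemma ae_eq_walk (hS : IsRandomWalk S P) :
    ∀ᵐ ω ∂P, ∀ n, S n ω = walk n (increments S ω) := by
  filter_upwards [hS.start] with ω h0 n using eq_walk_increments h0 n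

variable [MeasurableSingletonClass G]

lemma measurableSet_firstReturnTime_lt_top (hS : IsRandomWalk S P) :
    MeasurableSet {ω | firstReturnTime S ω < ⊤} := by
  simp_rw [firstReturnTime_eq, returnTime_one_lt_top_iff]
  have : {ω | ∃ k, 1 ≤ k ∧ S k ω = 1} = ⋃ k ∈ Set.Ici 1, S k ⁻¹' {1} := by
    ext ω
    simp
  rw [this]
  exact MeasurableSet.biUnion (Set.to_countable _) fun k _ =>
    hS.measurable k (measurableSet_singleton 1)

variable [Countable G]

lemma measurable_multipleRange (n j : ℕ) :
    Measurable fun x : ℕ → G => (multipleRange walk n j x : ℝ≥0∞) :=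
  measurable_comp_localTimeBefore n fun v => (({z | v z = j}.encard : ℕ∞) : ℝ≥0∞)

lemma measurable_increments (hS : IsRandomWalk S P) : Measurable (increments S) :=
  measurable_pi_iff.2 fun n => (hS.measurable n).inv.mul (hS.measurable (n + 1))

lemma map_increments (hS : IsRandomWalk S P) :
    P.map (increments S) = incrementLaw (stepLaw S P) := by
  have h := hS.indep.map_fun_eq_infinitePi_map
    fun n => (hS.measurable n).inv.mul (hS.measurable (n + 1))
  refine h.trans ?_
  congr 1
  exact funext fun n => (hS.identDistrib n).map_eq

lemma lintegral_eq (hS : IsRandomWalk S P) {F : Ω → ℝ≥0∞} {Φ : (ℕ → G) → ℝ≥0∞}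
    (hΦ : Measurable Φ) (h : ∀ ω x, (∀ n, S n ω = walk n x) → F ω = Φ x) :
    ∫⁻ ω, F ω ∂P = ∫⁻ x, Φ x ∂(incrementLaw (stepLaw S P)) := by
  rw [← hS.map_increments, lintegral_map hΦ hS.measurable_increments]
  refine lintegral_congr_ae ?_
  filter_upwards [hS.ae_eq_walk] with ω hω using h ω _ hω

lemma measure_eq (hS : IsRandomWalk S P) {p : Ω → Prop} {A : Set (ℕ → G)}
    (hA : MeasurableSet A) (h : ∀ ω x, (∀ n, S n ω = walk n x) → (p ω ↔ x ∈ A)) :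
    P {ω | p ω} = incrementLaw (stepLaw S P) A := by
  rw [← hS.map_increments, Measure.map_apply hS.measurable_increments hA]
  refine measure_congr ?_
  filter_upwards [hS.ae_eq_walk] with ω hω
  exact propext (h ω _ hω)

lemma lintegral_multipleRange_eq (hS : IsRandomWalk S P) (n j : ℕ) :
    ∫⁻ ω, (multipleRange S n j ω : ℝ≥0∞) ∂P =
      ∫⁻ x, (multipleRange walk n j x : ℝ≥0∞) ∂(incrementLaw (stepLaw S P)) :=
  hS.lintegral_eq (measurable_multipleRange n j) fun _ _ h => by
    rw [multipleRange_eq_of_forall h]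

lemma lintegral_sub_returnTime_eq (hS : IsRandomWalk S P) (n r : ℕ) :
    ∫⁻ ω, ((n : ℝ≥0∞) - (returnTime S r ω : ℝ≥0∞)) ∂P =
      ∫⁻ x, ((n : ℝ≥0∞) - (returnTime walk r x : ℝ≥0∞)) ∂(incrementLaw (stepLaw S P)) :=
  hS.lintegral_eq ((Measurable.of_discrete (f := fun t : ℕ∞ => (n : ℝ≥0∞) - (t : ℝ≥0∞))).comp
    (measurable_returnTime r)) fun _ _ h => by rw [returnTime_eq_of_forall h]

variable [IsProbabilityMeasure P]

lemma isProbabilityMeasure_stepLaw (hS : IsRandomWalk S P) :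
    IsProbabilityMeasure (stepLaw S P) :=
  Measure.isProbabilityMeasure_map
    ((measurable_pi_apply 0).comp hS.measurable_increments).aemeasurable

lemma ofReal_escapeProb (hS : IsRandomWalk S P) :
    ENNReal.ofReal (escapeProb S P) = incrementLaw (stepLaw S P) (neverReturns G) := by
  rw [escapeProb, ofReal_measureReal]
  exact hS.measure_eq measurableSet_neverReturns fun ω x h => by simp [h, neverReturns]

lemma ofReal_one_sub_escapeProb (hS : IsRandomWalk S P) :
    ENNReal.ofReal (1 - escapeProb S P) =
      incrementLaw (stepLaw S P) {x | returnTime walk 1 x < ⊤} := by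
  have := hS.isProbabilityMeasure_stepLaw
  rw [ENNReal.ofReal_sub _ escapeProb_nonneg, ENNReal.ofReal_one, hS.ofReal_escapeProb,
    ← measure_neverReturns_add (stepLaw S P), ENNReal.add_sub_cancel_left (by finiteness)]

lemma measure_firstReturnTime_lt_top (hS : IsRandomWalk S P) :
    P {ω | firstReturnTime S ω < ⊤} = ENNReal.ofReal (1 - escapeProb S P) := by
  rw [hS.ofReal_one_sub_escapeProb]
  exact hS.measure_eq (measurableSet_returnTime_lt_top 1) fun ω x h => by
    rw [firstReturnTime_eq, returnTime_eq_of_forall h]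
    rfl

theorem mul_lintegral_returnTime_le (hS : IsRandomWalk S P) (n r : ℕ) :
    ENNReal.ofReal (escapeProb S P ^ 2) *
        ∫⁻ ω, ((n : ℝ≥0∞) - (returnTime S r ω : ℝ≥0∞)) ∂P ≤
      ∫⁻ ω, (multipleRange S n (r + 1) ω : ℝ≥0∞) ∂P := by
  have := hS.isProbabilityMeasure_stepLaw
  rw [hS.lintegral_multipleRange_eq, hS.lintegral_sub_returnTime_eq,
    ENNReal.ofReal_pow escapeProb_nonneg, hS.ofReal_escapeProb]
  exact mul_lintegral_returnTime_le_multipleRange _ n r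

/-- If the mean of the first return time, conditioned to be finite, is finite, then it has an
integer upper bound. -/
lemma exists_meanReturnTime_le (hS : IsRandomWalk S P)
    (hpos : 0 < P {ω | firstReturnTime S ω < ⊤})
    (hfin : ∫⁻ ω, (firstReturnTime S ω : ℝ≥0∞)
      ∂(P[|{ω | firstReturnTime S ω < ⊤}]) < ⊤) :
    ∃ M : ℕ, 0 < M ∧ meanReturnTime (stepLaw S P) 1 ≤
      incrementLaw (stepLaw S P) {x | returnTime walk 1 x < ⊤} * M := by
  set s := {ω | firstReturnTime S ω < ⊤} with hs
  have h1 : ∫⁻ ω in s, (firstReturnTime S ω : ℝ≥0∞) ∂P = meanReturnTime (stepLaw S P) 1 := by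
    rw [← lintegral_indicator hS.measurableSet_firstReturnTime_lt_top]
    refine hS.lintegral_eq ((Measurable.of_discrete
      (f := fun t : ℕ∞ => if t = ⊤ then 0 else (t : ℝ≥0∞))).comp
        (measurable_returnTime 1)) fun ω x h => ?_
    rw [← returnTime_eq_of_forall h 1, ← firstReturnTime_eq]
    by_cases h' : firstReturnTime S ω = ⊤ <;> simp [h', lt_top_iff_ne_top]
  rw [ProbabilityTheory.cond, lintegral_smul_measure, h1, smul_eq_mul] at hfin
  obtain ⟨M, hM⟩ := ENNReal.exists_nat_gt hfin.ne
  -- The successor keeps the bound positive even when M = 0; it is a divisor later.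
  refine ⟨M + 1, M.succ_pos, ?_⟩
  have hP : P s = incrementLaw (stepLaw S P) {x | returnTime walk 1 x < ⊤} := by
    rw [hS.measure_firstReturnTime_lt_top, hS.ofReal_one_sub_escapeProb]
  rw [← hP]
  calc meanReturnTime (stepLaw S P) 1
      = P s * ((P s)⁻¹ * meanReturnTime (stepLaw S P) 1) := by
        rw [← mul_assoc, ENNReal.mul_inv_cancel hpos.ne' (by finiteness), one_mul]
    _ ≤ P s * (M + 1 : ℕ) := by
        refine mul_le_mul_right (hM.le.trans ?_) _
        exact_mod_cast M.le_succ

lemma memLp_localTimeSum (hS : IsRandomWalk S P) {f : ℕ → ℝ} (hf : f 0 = 0) (n : ℕ) (c : ℝ) :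
    MemLp (fun ω => localTimeSum S f n ω / c) 2 P := by
  have hm : AEMeasurable (fun ω => localTimeSum S f n ω) P := by
    refine ⟨fun ω => localTimeSum walk f n (increments S ω), ?_, ?_⟩
    · exact (measurable_comp_localTimeBefore n fun v : G → ℕ => ∑' z, f (v z)).comp
        hS.measurable_increments
    · filter_upwards [hS.ae_eq_walk] with ω hω using localTimeSum_eq_of_forall hω f n
  -- For c = 0 both the function and the bound are 0.
  refine MemLp.of_bound (hm.div_const c).aestronglyMeasurable
    ((n * ∑ j ∈ Finset.range (n + 1), |f j|) / |c|) (ae_of_all _ fun ω => ?_)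
  rw [Real.norm_eq_abs, abs_div]
  gcongr
  exact abs_localTimeSum_le hf n

lemma measure_localTimeSum_ne_zero_le (hS : IsRandomWalk S P) {h : ℕ → ℝ} {m : ℕ}
    (hh : ∀ j ≤ m, h j = 0) (n : ℕ) :
    P {ω | localTimeSum S h n ω ≠ 0} ≤ ENNReal.ofReal (n * (1 - escapeProb S P) ^ m) := by
  have := hS.isProbabilityMeasure_stepLaw
  have hnn : 0 ≤ 1 - escapeProb S P := sub_nonneg.2 escapeProb_le_one
  calc P {ω | localTimeSum S h n ω ≠ 0}
      ≤ P {ω | ∃ z, m < localTimeBefore S n z ω} := measure_mono fun ω hω =>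
        exists_lt_localTimeBefore_of_localTimeSum_ne_zero hh hω
    _ = incrementLaw (stepLaw S P) {x | ∃ z, m < localTimeBefore walk n z x} :=
        hS.measure_eq (measurableSet_localTimeBefore n fun v => ∃ z, m < v z) fun ω x h => by
          simp [localTimeBefore_eq_of_forall h]
    _ ≤ _ := by
        rw [ENNReal.ofReal_mul n.cast_nonneg, ENNReal.ofReal_natCast, ENNReal.ofReal_pow hnn,
          hS.ofReal_one_sub_escapeProb]
        exact measure_exists_lt_localTimeBefore_le _ n m

/-- The horizon 4Mm is chosen so that the loss rM ≤ 2Mm is at most half of it. -/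
lemma ofReal_le_lintegral_multipleRange (hS : IsRandomWalk S P) {M : ℕ}
    (hM : meanReturnTime (stepLaw S P) 1 ≤
      incrementLaw (stepLaw S P) {x | returnTime walk 1 x < ⊤} * M) {m r : ℕ}
    (hr : r ≤ 2 * m) :
    ENNReal.ofReal (escapeProb S P ^ 2 * ((2 * M * m) * (1 - escapeProb S P) ^ r)) ≤
      ∫⁻ ω, (multipleRange S (4 * M * m) (r + 1) ω : ℝ≥0∞) ∂P := by
  have := hS.isProbabilityMeasure_stepLaw
  have hnn : 0 ≤ 1 - escapeProb S P := sub_nonneg.2 escapeProb_le_one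
  refine le_trans ?_ (hS.mul_lintegral_returnTime_le (4 * M * m) r)
  rw [ENNReal.ofReal_mul (sq_nonneg _)]
  refine mul_le_mul_right ?_ _
  have h := mul_pow_le_lintegral_returnTime (stepLaw S P) hM (4 * M * m) r
  rw [← hS.lintegral_sub_returnTime_eq, ← hS.ofReal_one_sub_escapeProb,
    ← ENNReal.ofReal_pow hnn] at h
  set I := ∫⁻ ω, (((4 * M * m : ℕ) : ℝ≥0∞) - (returnTime S r ω : ℝ≥0∞)) ∂P
  set Q := ENNReal.ofReal ((1 - escapeProb S P) ^ r) with hQ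
  have h2 : ENNReal.ofReal ((2 * M * m) * (1 - escapeProb S P) ^ r) = (2 * M * m : ℕ) * Q := by
    rw [ENNReal.ofReal_mul (by positivity), ← ENNReal.ofReal_natCast (2 * M * m)]
    push_cast
    rfl
  rw [h2]
  have h3 : (2 * M * m : ℕ) * Q + (2 * M * m : ℕ) * Q ≤ I + (2 * M * m : ℕ) * Q := by
    refine le_trans (le_of_eq ?_) (h.trans (add_le_add_right ?_ I))
    · rw [← add_mul, ← Nat.cast_add]
      congr 2
      ring
    · calc (r : ℝ≥0∞) * (Q * M) = (r * M : ℕ) * Q := by push_cast; ring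
        _ ≤ _ := by
          refine mul_le_mul_left ?_ _
          have : r * M ≤ 2 * M * m := by
            calc r * M ≤ 2 * m * M := Nat.mul_le_mul_right M hr
              _ = _ := by ring
          exact_mod_cast this
  exact (ENNReal.add_le_add_iff_right (by finiteness)).1 h3

end IsRandomWalk

end Transfer

/-! ### The critical function and the two series -/

section CriticalFunction

variable {q : ℝ} {f : ℕ → ℝ}

lemma sq_mul_pow_eq_one (hq : 0 < q) (hf : ∀ j : ℕ, 1 ≤ j → f j = q ^ (-(j : ℝ) / 2)) {j : ℕ}
    (hj : 1 ≤ j) : f j ^ 2 * q ^ j = 1 := by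
  rw [hf j hj, ← Real.rpow_natCast, ← Real.rpow_mul hq.le, ← Real.rpow_natCast,
    ← Real.rpow_add hq]
  norm_num

lemma not_summable_sq_mul_pow_div (hq : 0 < q)
    (hf : ∀ j : ℕ, 1 ≤ j → f j = q ^ (-(j : ℝ) / 2)) :
    ¬ Summable fun j : ℕ => f (j + 1) ^ 2 * q ^ (j + 1) / ((j + 1 : ℕ) : ℝ) := by
  simp_rw [sq_mul_pow_eq_one hq hf (Nat.le_add_left 1 _)]
  rw [summable_nat_add_iff (f := fun j : ℕ => 1 / (j : ℝ)) 1]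
  exact Real.not_summable_one_div_natCast

lemma summable_sq_mul_pow_div_rpow (hq : 0 < q)
    (hf : ∀ j : ℕ, 1 ≤ j → f j = q ^ (-(j : ℝ) / 2)) {δ : ℝ} (hδ : 0 < δ) :
    Summable fun j : ℕ => f (j + 1) ^ 2 * q ^ (j + 1) / ((j + 1 : ℕ) : ℝ) ^ (1 + δ) := by
  simp_rw [sq_mul_pow_eq_one hq hf (Nat.le_add_left 1 _)]
  rw [summable_nat_add_iff (f := fun j : ℕ => 1 / (j : ℝ) ^ (1 + δ)) 1]
  exact Real.summable_one_div_nat_rpow.2 (by linarith)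

end CriticalFunction

lemma ofReal_le_eLpNorm_two_sq {Ω : Type*} [MeasurableSpace Ω] {P : Measure Ω} {Z : Ω → ℝ}
    {c : ℝ≥0∞} (h : c ≤ ∫⁻ ω, ENNReal.ofReal (Z ω ^ 2) ∂P) : c ≤ eLpNorm Z 2 P ^ 2 := by
  rw [← ENNReal.rpow_natCast, eLpNorm_eq_lintegral_rpow_enorm_toReal (by norm_num) (by norm_num),
    ← ENNReal.rpow_mul]
  simp only [ENNReal.toReal_ofNat, Nat.cast_ofNat, one_div, ne_eq, OfNat.ofNat_ne_zero,
    not_false_eq_true, inv_mul_cancel₀, ENNReal.rpow_one]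
  refine h.trans (lintegral_mono fun ω => ?_)
  rw [← sq_abs, ENNReal.ofReal_pow (abs_nonneg _), ← Real.norm_eq_abs, ofReal_norm]
  norm_num

/-! ### Second moment of the window and failure of convergence -/

section

variable {Ω G : Type*} [MeasurableSpace Ω] {P : Measure Ω} [IsProbabilityMeasure P]
  [Group G] [Countable G] [MeasurableSpace G] [MeasurableSingletonClass G] {S : ℕ → Ω → G}

/-- The part of `f` supported on `(m, 2m]`. -/
def window (f : ℕ → ℝ) (m : ℕ) : ℕ → ℝ := (Set.Ioc m (2 * m)).indicator f

lemma window_eq_zero (f : ℕ → ℝ) {m j : ℕ} (h : j ≤ m) : window f m j = 0 :=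
  Set.indicator_of_notMem (fun hj => not_lt.2 h hj.1) f

lemma window_nonneg {f : ℕ → ℝ} (hf : ∀ j, 0 ≤ f j) (m j : ℕ) : 0 ≤ window f m j :=
  Set.indicator_nonneg (fun _ _ => hf _) j

lemma window_le {f : ℕ → ℝ} (hf : ∀ j, 0 ≤ f j) (m j : ℕ) : window f m j ≤ f j :=
  Set.indicator_le_self' (fun _ _ => hf _) j

lemma IsRandomWalk.ofReal_le_lintegral_localTimeSum_window_sq (hS : IsRandomWalk S P) {M : ℕ}
    (hM : meanReturnTime (stepLaw S P) 1 ≤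
      incrementLaw (stepLaw S P) {x | returnTime walk 1 x < ⊤} * M)
    {f : ℕ → ℝ} (hnn : ∀ j, 0 ≤ f j)
    (hf : ∀ j, 1 ≤ j → f j ^ 2 * (1 - escapeProb S P) ^ j = 1) (m : ℕ) :
    ENNReal.ofReal (escapeProb S P ^ 2 * (2 * M * m ^ 2)) ≤
      ∫⁻ ω, ENNReal.ofReal (localTimeSum S (window f m) (4 * M * m) ω ^ 2) ∂P := by
  have hq0 : 0 ≤ 1 - escapeProb S P := sub_nonneg.2 escapeProb_le_one
  have hq1 : 1 - escapeProb S P ≤ 1 := sub_le_self _ escapeProb_nonneg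
  have hm : ∀ j, AEMeasurable (fun ω => (multipleRange S (4 * M * m) j ω : ℝ≥0∞)) P := fun j =>
    ⟨_, (measurable_multipleRange (4 * M * m) j).comp hS.measurable_increments, by
      filter_upwards [hS.ae_eq_walk] with ω hω
      simp [multipleRange_eq_of_forall hω]⟩
  have hterm : ∀ j ∈ Finset.Ioc m (2 * m),
      ENNReal.ofReal (escapeProb S P ^ 2 * (2 * M * m)) ≤
        ENNReal.ofReal (window f m j ^ 2) *
          ∫⁻ ω, (multipleRange S (4 * M * m) j ω : ℝ≥0∞) ∂P := by
    intro j hj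
    obtain ⟨hj1, hj2⟩ := Finset.mem_Ioc.1 hj
    obtain ⟨r, rfl⟩ := Nat.exists_eq_add_one_of_ne_zero (Nat.ne_zero_of_lt hj1)
    refine le_trans ?_ (mul_le_mul_right
      (hS.ofReal_le_lintegral_multipleRange hM (m := m) (r := r) (by omega)) _)
    rw [window, Set.indicator_of_mem (Set.mem_Ioc.2 ⟨hj1, hj2⟩),
      ← ENNReal.ofReal_mul (sq_nonneg _)]
    refine ENNReal.ofReal_le_ofReal ?_
    -- The range with r + 1 visits carries q^r, while f is normalized by q^(r+1); the mismatch is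
    -- favourable since q ≤ 1.
    have h1 : 1 ≤ f (r + 1) ^ 2 * (1 - escapeProb S P) ^ r := by
      refine (hf (r + 1) (by omega)).ge.trans (mul_le_mul_of_nonneg_left ?_ (sq_nonneg _))
      exact pow_le_pow_of_le_one hq0 hq1 r.le_succ
    calc escapeProb S P ^ 2 * (2 * M * m)
        ≤ escapeProb S P ^ 2 * (2 * M * m) * (f (r + 1) ^ 2 * (1 - escapeProb S P) ^ r) :=
          le_mul_of_one_le_right (by positivity) h1
      _ = _ := by ring
  calc ENNReal.ofReal (escapeProb S P ^ 2 * (2 * M * m ^ 2))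
      = ∑ j ∈ Finset.Ioc m (2 * m), ENNReal.ofReal (escapeProb S P ^ 2 * (2 * M * m)) := by
        rw [Finset.sum_const, Nat.card_Ioc, nsmul_eq_mul, ← ENNReal.ofReal_natCast,
          ← ENNReal.ofReal_mul (by positivity), show 2 * m - m = m by omega]
        congr 1
        ring
    _ ≤ ∑ j ∈ Finset.Ioc m (2 * m), ENNReal.ofReal (window f m j ^ 2) *
          ∫⁻ ω, (multipleRange S (4 * M * m) j ω : ℝ≥0∞) ∂P := Finset.sum_le_sum hterm
    _ = ∫⁻ ω, ∑ j ∈ Finset.Ioc m (2 * m), ENNReal.ofReal (window f m j ^ 2) *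
          (multipleRange S (4 * M * m) j ω : ℝ≥0∞) ∂P := by
        rw [lintegral_finsetSum' _ fun j _ => (hm j).const_mul _]
        exact Finset.sum_congr rfl fun j _ => (lintegral_const_mul'' _ (hm j)).symm
    _ ≤ _ := lintegral_mono fun ω => sum_mul_multipleRange_le (window_eq_zero f (Nat.zero_le m))
        (window_nonneg hnn m) _ (by simp)

theorem IsRandomWalk.not_tendsto_localTimeSum_div (hS : IsRandomWalk S P)
    (hγ : 0 < escapeProb S P) (hpos : 0 < P {ω | firstReturnTime S ω < ⊤})
    (hfin : ∫⁻ ω, (firstReturnTime S ω : ℝ≥0∞)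
      ∂(P[|{ω | firstReturnTime S ω < ⊤}]) < ⊤)
    {f : ℕ → ℝ} (hf0 : f 0 = 0) (hnn : ∀ j, 0 ≤ f j)
    (hf : ∀ j, 1 ≤ j → f j ^ 2 * (1 - escapeProb S P) ^ j = 1) {g : Ω → ℝ} (hg : MemLp g 2 P) :
    ¬ Tendsto (fun n : ℕ => eLpNorm (fun ω => localTimeSum S f n ω / n - g ω) 2 P)
      atTop (𝓝 0) := by
  intro hlim
  obtain ⟨M, hM0, hM⟩ := hS.exists_meanReturnTime_le hpos hfin
  have hM0' : (0 : ℝ) < M := by exact_mod_cast hM0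
  have hq0 : 0 ≤ 1 - escapeProb S P := sub_nonneg.2 escapeProb_le_one
  have hw0 : ∀ m, window f m 0 = 0 := fun m => window_eq_zero f (Nat.zero_le m)
  have hlim0 := tendsto_eLpNorm_zero_of_le_of_measure_ne_zero
    (Z := fun m ω => localTimeSum S (window f m) (4 * M * m) ω / (4 * M * m : ℕ))
    (fun m => 4 * M * m) (fun n => hS.memLp_localTimeSum hf0 n n) hg hlim
    (fun m => (hS.memLp_localTimeSum (hw0 m) _ _).aestronglyMeasurable) (fun m ω => ?_) ?_
  · have hsq : Tendsto (fun m : ℕ => eLpNorm (fun ω => localTimeSum S (window f m) (4 * M * m) ω /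
        (4 * M * m : ℕ)) 2 P ^ 2) atTop (𝓝 0) := by
      simpa using ENNReal.Tendsto.pow (n := 2) hlim0
    -- This constant is 2γ²Mm² / (4Mm)², independent of m.
    have hc : 0 < ENNReal.ofReal (escapeProb S P ^ 2 / (8 * M)) := by positivity
    refine absurd (ge_of_tendsto hsq ?_) (not_le.2 hc)
    filter_upwards [eventually_gt_atTop 0] with m hm
    have hm' : (0 : ℝ) < m := by exact_mod_cast hm
    refine ofReal_le_eLpNorm_two_sq ?_
    simp only [div_pow, div_eq_mul_inv (localTimeSum _ _ _ _ ^ 2)]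
    simp_rw [ENNReal.ofReal_mul (sq_nonneg (localTimeSum S (window f m) (4 * M * m) _))]
    rw [lintegral_mul_const' _ _ ENNReal.ofReal_ne_top]
    refine le_trans (le_of_eq ?_) (mul_le_mul_left
      (hS.ofReal_le_lintegral_localTimeSum_window_sq hM hnn hf m) _)
    rw [← ENNReal.ofReal_mul (by positivity)]
    congr 1
    push_cast
    field_simp
    norm_num
  · rw [abs_div, abs_div, abs_of_nonneg (localTimeSum_nonneg (window_nonneg hnn m) _),
      abs_of_nonneg (localTimeSum_nonneg hnn _)]
    gcongr
    exact localTimeSum_le_localTimeSum hf0 (hw0 m) (window_le hnn m) _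
  · have h0 : Tendsto (fun m : ℕ =>
        ENNReal.ofReal ((4 * M * m : ℕ) * (1 - escapeProb S P) ^ m)) atTop (𝓝 0) := by
      rw [← ENNReal.ofReal_zero]
      refine ENNReal.tendsto_ofReal ?_
      have h := (tendsto_self_mul_const_pow_of_lt_one hq0 (sub_lt_self 1 hγ)).const_mul (4 * M : ℝ)
      rw [mul_zero] at h
      refine h.congr fun m => ?_
      push_cast
      ring
    refine tendsto_of_tendsto_of_tendsto_of_le_of_le tendsto_const_nhds h0 (fun _ => zero_le)
      fun m => le_trans (measure_mono fun ω hω => ?_)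
        (hS.measure_localTimeSum_ne_zero_le (h := window f m) (fun j hj => window_eq_zero f hj)
          (4 * M * m))
    exact (div_ne_zero_iff.1 hω).1

end

end GroupWalk

end

theorem mainTheorem3 {Ω G : Type*} [MeasurableSpace Ω] (P : Measure Ω) [IsProbabilityMeasure P]
    [Group G] [Countable G] [MeasurableSpace G] [MeasurableSingletonClass G]
    (S : ℕ → Ω → G) (hS : GroupWalk.IsRandomWalk S P) (htrans : GroupWalk.IsTransient S P) :
    -- lower bound for the expected multiple range
    (∀ n j : ℕ, 1 ≤ j →
      ENNReal.ofReal (GroupWalk.escapeProb S P ^ 2) *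
          ∫⁻ ω, ((n : ℝ≥0∞) - (GroupWalk.returnTime S (j - 1) ω : ℝ≥0∞)) ∂P
        ≤ ∫⁻ ω, (GroupWalk.multipleRange S n j ω : ℝ≥0∞) ∂P) ∧
    -- failure of convergence in mean square for a barely inadmissible function
    (0 < P {ω | GroupWalk.firstReturnTime S ω < ⊤} →
      ∫⁻ ω, (GroupWalk.firstReturnTime S ω : ℝ≥0∞)
        ∂(P[|{ω | GroupWalk.firstReturnTime S ω < ⊤}]) < ⊤ →
      ∀ f : ℕ → ℝ, f 0 = 0 →
        (∀ j : ℕ, 1 ≤ j → f j = (1 - GroupWalk.escapeProb S P) ^ (-(j : ℝ) / 2)) →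
        (¬ Summable fun j : ℕ =>
          f (j + 1) ^ 2 * (1 - GroupWalk.escapeProb S P) ^ (j + 1) / ((j + 1 : ℕ) : ℝ)) ∧
        (∀ δ : ℝ, 0 < δ → Summable fun j : ℕ =>
          f (j + 1) ^ 2 * (1 - GroupWalk.escapeProb S P) ^ (j + 1) /
            ((j + 1 : ℕ) : ℝ) ^ (1 + δ)) ∧
        (∀ n : ℕ, MemLp (fun ω => GroupWalk.localTimeSum S f n ω / n) 2 P) ∧
        ¬ ∃ g : Ω → ℝ, MemLp g 2 P ∧
          Tendsto (fun n : ℕ =>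
            eLpNorm (fun ω => GroupWalk.localTimeSum S f n ω / n - g ω) 2 P) atTop (𝓝 0)) := by
  refine ⟨fun n j hj => ?_, fun hpos hfin f hf0 hf => ?_⟩
  · have h := hS.mul_lintegral_returnTime_le n (j - 1)
    rwa [Nat.sub_add_cancel hj] at h
  · have hq : 0 < 1 - GroupWalk.escapeProb S P := by
      rwa [hS.measure_firstReturnTime_lt_top, ENNReal.ofReal_pos] at hpos
    have hnn : ∀ j, 0 ≤ f j := fun j => by
      rcases Nat.eq_zero_or_pos j with rfl | hj
      · exact hf0.ge
      · rw [hf j hj]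
        exact Real.rpow_nonneg hq.le _
    exact ⟨GroupWalk.not_summable_sq_mul_pow_div hq hf,
      fun δ hδ => GroupWalk.summable_sq_mul_pow_div_rpow hq hf hδ,
      fun n => hS.memLp_localTimeSum hf0 n n,
      fun ⟨g, hg, hlim⟩ => hS.not_tendsto_localTimeSum_div htrans hpos hfin hf0 hnn
        (fun j hj => GroupWalk.sq_mul_pow_eq_one hq hf hj) hg hlim⟩
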